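/- **Setting.** Macro base stations (MBSs) form a homogeneous Poisson point process $\Phi_M$ of density $\lambda_m>0$ in $\mathbb R^2$. Small base stations (SBSs) on the road of the typical vehicle form a homogeneous Poisson point process $\Xi_S$ of density $\lambda_s>0$ on $\mathbb R$ (the coordinate along the road). The typical vehicle is at the origin. Every MBS carries a shadowing gain $\chi_M$ and every SBS a gain $\chi_S$, with $10\log_{10}\chi_i\sim N(\omega_i,\delta_i^2)$ for $i\in\{M,S\}$; the gains of the different base stations, and the two point processes, are all independent. Let $\alpha_M,\alpha_S>0$ be the path-loss exponents, let $$X_M=\min_{x\in\Phi_M}\|\chi_M^{-1/\alpha_M}x\|,\qquad X_S=\min_{x\in\Xi_S}|\chi_S^{-1/\alpha_S}x|$$ be the distances to the nearest MBS and SBS after displacing each station $x$ to $\chi^{-1/\alpha}x$, and let $$\lambda_M=\lambda_m\,E[\chi_M^{2/\alpha_M}],\qquad \lambda_S=\lambda_s\,E[\chi_S^{1/\alpha_S}]$$ be the densities of the displaced processes. With transmit powers $P_M,P_S,P_V>0$ and antenna gains $G_M,G_{S,0},G_{V,0},G_{V,1}>0$, the vehicle is associated with an MBS in the downlink (DL)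 if $P_MG_MX_M^{-\alpha_M}>P_SG_{S,0}X_S^{-\alpha_S}$ and with an SBS otherwise; it is associated with an MBS in the uplink (UL) if $P_VG_{V,1}X_M^{-\alpha_M}>P_VG_{V,0}X_S^{-\alpha_S}$ and with an SBS otherwise. Put $A_{M,S}=\frac{P_MG_M}{P_SG_{S,0}}$ and $B_{M,S}=\frac{P_VG_{V,1}}{P_VG_{V,0}}$, and assume $A_{M,S}>B_{M,S}$. Case 2 is the event that the vehicle is associated with an SBS in the UL and with an MBS in the DL. **Lemma 2.** The densities $\lambda_M,\lambda_S$ are finite and positive, the integrals below converge, $$\Pr(\text{Case 2})=\Pr\left(B_{M,S}X_M^{-\alpha_M}<X_S^{-\alpha_S}<A_{M,S}X_M^{-\alpha_M}\right),$$ and $$\Pr(\text{Case 2})=\int_0^\infty 2\lambda_S\exp\left(-\lambda_M\pi B_{M,S}^{2/\alpha_M}x^{2\alpha_S/\alpha_M}-2\lambda_Sx\right)dx-\int_0^\infty 2\lambda_S\exp\left(-\lambda_M\pi A_{M,S}^{2/\alpha_M}x^{2\alpha_S/\alpha_M}-2\lambda_Sx\right)dx.$$ If $\alpha_S=\alpha_M=\alpha$,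 then, with $\operatorname{erfc}(z)=\frac{2}{\sqrt\pi}\int_z^\infty e^{-t^2}dt$, $$\Pr(\text{Case 2})=\sqrt{\tfrac{\lambda_S^2}{\lambda_MB_{M,S}^{2/\alpha}}}\exp\left(\tfrac{\lambda_S^2}{\lambda_M\pi B_{M,S}^{2/\alpha}}\right)\operatorname{erfc}\left(\tfrac{\lambda_S}{\sqrt{\lambda_M\pi B_{M,S}^{2/\alpha}}}\right)-\sqrt{\tfrac{\lambda_S^2}{\lambda_MA_{M,S}^{2/\alpha}}}\exp\left(\tfrac{\lambda_S^2}{\lambda_M\pi A_{M,S}^{2/\alpha}}\right)\operatorname{erfc}\left(\tfrac{\lambda_S}{\sqrt{\lambda_M\pi A_{M,S}^{2/\alpha}}}\right).$$ -/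

import Mathlib

open MeasureTheory ProbabilityTheory
open scoped NNReal ENNReal

noncomputable section

/-- The complementary error function `erfc x = (2 / √π) ∫_x^∞ exp (-t²) dt`. -/
def erfc (x : ℝ) : ℝ :=
  2 / Real.sqrt Real.pi * ∫ t in Set.Ioi x, Real.exp (-t ^ 2)

/-- The number of points of the random sequence `X` that lie in the set `A`. -/
def pointCount {Ω E : Type*} (X : ℕ → Ω → E) (A : Set E) (ω : Ω) : ℕ∞ :=
  Set.encard {n | X n ω ∈ A}

/-- `X 0, X 1, …` is a (measurable) enumeration of the points of a Poisson point process with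
intensity measure `Λ`: the number of points in a set `A` of finite intensity has the Poisson law
with mean `Λ A`, and the numbers of points in disjoint sets are independent.  It is used for
`Λ = lam • volume` with `lam > 0`, where the process almost surely has infinitely many points, so
that `ℕ` is the right index set. -/
structure IsPoissonProcess {Ω E : Type*} [MeasurableSpace Ω] [MeasurableSpace E]
    (P : Measure Ω) (Λ : Measure E) (X : ℕ → Ω → E) : Prop where
  measurable : ∀ n, Measurable (X n)
  law_count : ∀ A : Set E, MeasurableSet A → Λ A < ∞ → ∀ k : ℕ,
    P {ω | pointCount X A ω = k} = poissonMeasure (Λ A).toNNReal {k}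
  indep_count : ∀ (m : ℕ) (A : Fin m → Set E), (∀ i, MeasurableSet (A i)) → (∀ i, Λ (A i) < ∞) →
    Pairwise (fun i j => Disjoint (A i) (A j)) → iIndepFun (fun i => pointCount X (A i)) P

/-- The log-normal law of a shadowing gain `χ` with `10 log₁₀ χ ∼ N(w, δ²)`. -/
def shadowingLaw (w : ℝ) (δ : ℝ≥0) : Measure ℝ :=
  (gaussianReal w (δ ^ 2)).map (fun t => (10 : ℝ) ^ (t / 10))

/-- A homogeneous Poisson point process `X` of density `lam` whose points carry shadowing gains
`χ`, the gains being i.i.d. log-normal and independent of the points. -/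
structure IsShadowedPPP {Ω E : Type*} [MeasurableSpace Ω] [MeasureSpace E]
    (P : Measure Ω) (lam : ℝ) (w : ℝ) (δ : ℝ≥0) (X : ℕ → Ω → E) (χ : ℕ → Ω → ℝ) : Prop where
  poisson : IsPoissonProcess P (ENNReal.ofReal lam • (volume : Measure E)) X
  shadowing_measurable : ∀ n, Measurable (χ n)
  shadowing_law : ∀ n, P.map (χ n) = shadowingLaw w δ
  shadowing_indep : iIndepFun χ P
  indep : IndepFun (fun ω n => X n ω) (fun ω n => χ n ω) P

/-- The density `lam * E[χ ^ (d / α)]` of the displaced points `χ ^ (-1 / α) • x` of a shadowed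
Poisson process of density `lam` in dimension `d`. -/
def displacedDensity (d : ℕ) (lam α w : ℝ) (δ : ℝ≥0) : ℝ :=
  lam * ∫ c, c ^ ((d : ℝ) / α) ∂(shadowingLaw w δ)

/-- The distance from the origin (the typical vehicle) to the nearest of the displaced points
`χ n ^ (-1 / α) • X n`. -/
def nearestDist {Ω E : Type*} [NormedAddCommGroup E] [NormedSpace ℝ E] (α : ℝ)
    (X : ℕ → Ω → E) (χ : ℕ → Ω → ℝ) (ω : Ω) : ℝ :=
  ⨅ n, ‖(χ n ω ^ (-1 / α)) • X n ω‖

/-- The vehicle is associated with the MBS tier: the strongest power from that tier,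
`PM * GM * xM ^ (-αM)`, exceeds the strongest power `PS * GS * xS ^ (-αS)` from the SBS tier.
Otherwise it is associated with the SBS tier. -/
def AssocMBS (PM GM αM PS GS αS xM xS : ℝ) : Prop :=
  PM * GM * xM ^ (-αM) > PS * GS * xS ^ (-αS)

/-- The integrand `2 λ_S exp (-λ_M π K^(2/α_M) x^(2α_S/α_M) - 2 λ_S x)`. -/
def assocIntegrand (lamM lamS αM αS K x : ℝ) : ℝ :=
  2 * lamS * Real.exp (-lamM * Real.pi * K ^ (2 / αM) * x ^ (2 * αS / αM) - 2 * lamS * x)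

/-- The closed form
`√(λ_S² / (λ_M K^(2/α))) exp (λ_S² / (λ_M π K^(2/α))) erfc (λ_S / √(λ_M π K^(2/α)))`. -/
def assocClosedForm (lamM lamS α K : ℝ) : ℝ :=
  Real.sqrt (lamS ^ 2 / (lamM * K ^ (2 / α))) *
    Real.exp (lamS ^ 2 / (lamM * Real.pi * K ^ (2 / α))) *
      erfc (lamS / Real.sqrt (lamM * Real.pi * K ^ (2 / α)))

end

/-! The distances to the two tiers have explicit laws. A station with gain `c` is displaced into the
ball of radius `r` exactly when it lies in the ball of radius `r * c ^ (1 / α)`. Averaging the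
volume of that ball over the gain produces the moment in `displacedDensity`. A void probability for
the marked process then gives survival functions `exp (-π λ_M r²)` for `X_M` and `exp (-2 λ_S r)`
for `X_S` (`IsShadowedPPP.measure_le_nearestDist`).

The void probability comes from conditioning on the positions: a point at `x` avoids `D` with
probability `1 - f x`, where `f x` is the mark probability of the slice of `D` at `x`. The
generating functional `E ∏ (1 - f x) = exp (-∫ f dΛ)` finishes it. For simple `f` it expresses
independence of Poisson counts on the level sets; monotone approximation gives the general case.

Case 2 is a difference of nested events `K X_M ^ (-αM) ≤ X_S ^ (-αS)`, with `K = B` and `K = A`.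
Given `X_S = x`, such an event bounds `X_M` below by `K ^ (1 / αM) * x ^ (αS / αM)`; integrating its
probability against the exponential density of `X_S` gives `assocIntegrand`. Ties are null because
`X_S` has a density. For equal exponents the integral is Gaussian on a half-line, hence an `erfc`.
-/

/-! ### Poisson counts and the generating functional -/

theorem measurable_pointCount {Ω E : Type*} [MeasurableSpace Ω] [MeasurableSpace E]
    {X : ℕ → Ω → E} (hX : ∀ n, Measurable (X n)) {A : Set E} (hA : MeasurableSet A) :
    Measurable (pointCount X A) := by
  refine measurable_encard.comp (measurable_set_iff.2 fun n => ?_)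
  exact measurableSet_setOfPred.1 (hX n hA)

/-- The number of points in a set of finite intensity is almost surely finite. -/
theorem IsPoissonProcess.pointCount_ne_top {Ω E : Type*} [MeasurableSpace Ω] [MeasurableSpace E]
    {P : Measure Ω} [IsProbabilityMeasure P] {Λ : Measure E} {X : ℕ → Ω → E}
    (h : IsPoissonProcess P Λ X) {A : Set E} (hA : MeasurableSet A) (hΛ : Λ A < ∞) :
    ∀ᵐ ω ∂P, pointCount X A ω ≠ ⊤ := by
  have hm := measurable_pointCount h.measurable hA
  have hs : {ω | pointCount X A ω ≠ ⊤} = ⋃ k : ℕ, {ω | pointCount X A ω = k} := by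
    ext ω
    simp [ENat.ne_top_iff_exists, eq_comm]
  have hmk : ∀ k : ℕ, MeasurableSet {ω | pointCount X A ω = k} := fun k =>
    hm (measurableSet_singleton _)
  -- The Poisson weights on `ℕ` sum to one, leaving no mass for the value `⊤`.
  have hone : P {ω | pointCount X A ω ≠ ⊤} = 1 := by
    rw [hs, measure_iUnion (fun i j hij => ?_) hmk]
    · simp_rw [h.law_count A hA hΛ]
      rw [← measure_iUnion (fun i j hij => Set.disjoint_singleton.2 hij)
        (fun k => measurableSet_singleton k), Set.iUnion_of_singleton, measure_univ]
    · refine Set.disjoint_left.2 fun ω hi hj => hij ?_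
      exact Nat.cast_injective (R := ℕ∞) (Eq.trans (Eq.symm hi) hj)
  have hms : MeasurableSet {ω | pointCount X A ω ≠ ⊤} := by
    rw [hs]; exact .iUnion hmk
  exact (prob_compl_eq_zero_iff hms).2 hone

/-- The generating function of the number of points in a set of finite intensity. -/
theorem IsPoissonProcess.lintegral_pow_pointCount {Ω E : Type*} [MeasurableSpace Ω]
    [MeasurableSpace E] {P : Measure Ω} [IsProbabilityMeasure P] {Λ : Measure E} {X : ℕ → Ω → E}
    (h : IsPoissonProcess P Λ X) {A : Set E} (hA : MeasurableSet A) (hΛ : Λ A < ∞)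
    {v : ℝ≥0∞} (hv : v ≤ 1) :
    ∫⁻ ω, (1 - v) ^ (pointCount X A ω).toNat ∂P = ENNReal.ofReal (Real.exp (-(v * Λ A).toReal)) := by
  have hm := measurable_pointCount h.measurable hA
  have hmN : Measurable fun ω => (pointCount X A ω).toNat :=
    (Measurable.of_discrete (f := ENat.toNat)).comp hm
  -- `toNat` sends `⊤` to `0`; this default matters only on a null event.
  have hlaw : P.map (fun ω => (pointCount X A ω).toNat) = poissonMeasure (Λ A).toNNReal := by
    refine Measure.ext_of_singleton fun k => ?_
    rw [Measure.map_apply hmN (measurableSet_singleton k),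
      ← h.law_count A hA hΛ k]
    refine measure_congr ?_
    filter_upwards [h.pointCount_ne_top hA hΛ] with ω hω
    refine propext ?_
    change (pointCount X A ω).toNat = k ↔ pointCount X A ω = k
    lift pointCount X A ω to ℕ using hω with m
    simp
  rw [← lintegral_map (f := fun k : ℕ => (1 - v) ^ k) Measurable.of_discrete
    hmN, hlaw, lintegral_countable']
  simp only [poissonMeasure_singleton]
  lift v to ℝ≥0 using ne_top_of_le_ne_top ENNReal.one_ne_top hv
  lift Λ A to ℝ≥0 using hΛ.ne with l
  have hv' : v ≤ 1 := by exact_mod_cast hv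
  have hv1 : (1 : ℝ≥0∞) - v = ENNReal.ofReal (1 - v) := by
    rw [ENNReal.ofReal_sub _ v.coe_nonneg]; simp
  have hv2 : (0 : ℝ) ≤ 1 - v := sub_nonneg.2 hv'
  -- Exponential series at `(1 - v) * l`, with `-l + (1 - v) * l = -(v * l)`.
  have hsum : HasSum (fun k : ℕ => (1 - v : ℝ) ^ k * (Real.exp (-l) * l ^ k / k.factorial))
      (Real.exp (-(v * l))) := by
    convert! (NormedSpace.expSeries_div_hasSum_exp ((1 - v) * l : ℝ)).mul_left (Real.exp (-l)) using 1
    · funext k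
      rw [mul_pow]; ring
    · rw [← Real.exp_eq_exp_ℝ, ← Real.exp_add]; ring_nf
  simp only [ENNReal.toNNReal_coe]
  rw [hv1]
  rw [← ENNReal.coe_mul, ENNReal.coe_toReal, NNReal.coe_mul, ← hsum.tsum_eq,
    ENNReal.ofReal_tsum_of_nonneg (fun k => by positivity) hsum.summable]
  refine tsum_congr fun k => ?_
  rw [ENNReal.ofReal_mul (by positivity), ENNReal.ofReal_pow hv2]

/-- Only finitely many points have `f (x n) ≠ 0`, so the decreasing partial products stabilise; the
remaining factors are grouped by their value. -/
theorem iInf_prod_range_one_sub {E : Type*} {f : E → ℝ≥0∞} {x : ℕ → E} (s : Finset ℝ≥0∞)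
    (hs : ∀ n, f (x n) ≠ 0 → f (x n) ∈ s)
    (hfin : ∀ v ∈ s, {n | x n ∈ f ⁻¹' {v}}.encard ≠ ⊤) :
    ⨅ N, ∏ n ∈ Finset.range N, (1 - f (x n)) =
      ∏ v ∈ s, (1 - v) ^ ({n | x n ∈ f ⁻¹' {v}}.encard).toNat := by
  classical
  have hT : {n | f (x n) ∈ s}.Finite := by
    have : {n | f (x n) ∈ s} = ⋃ v ∈ s, {n | x n ∈ f ⁻¹' {v}} := by
      ext n; simp
    rw [this]
    exact s.finite_toSet.biUnion fun v hv => Set.encard_ne_top_iff.1 (hfin v hv)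
  have hanti : Antitone fun N => ∏ n ∈ Finset.range N, (1 - f (x n)) :=
    antitone_nat_of_succ_le fun N => by
      rw [Finset.prod_range_succ]
      exact mul_le_of_le_one_right' tsub_le_self
  have hprod : ∏ n ∈ hT.toFinset, (1 - f (x n)) =
      ∏ v ∈ s, (1 - v) ^ ({n | x n ∈ f ⁻¹' {v}}.encard).toNat := by
    rw [← Finset.prod_fiberwise_of_maps_to (t := s) (g := fun n => f (x n))
      (fun n hn => by simpa using hn)]
    refine Finset.prod_congr rfl fun v hv => ?_
    rw [Finset.prod_congr rfl (g := fun _ => 1 - v)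
      (fun n hn => by rw [(Finset.mem_filter.1 hn).2]), Finset.prod_const]
    congr 1
    have : {n | x n ∈ f ⁻¹' {v}} = ↑({n ∈ hT.toFinset | f (x n) = v}) := by
      ext n
      simp only [Set.mem_preimage, Set.mem_singleton_iff, Set.mem_ofPred_eq, Finset.coe_filter,
        Set.Finite.mem_toFinset]
      exact ⟨fun h => ⟨h ▸ hv, h⟩, fun h => h.2⟩
    rw [this, Set.encard_coe_eq_coe_finsetCard, ENat.toNat_natCast]
  rw [← hprod]
  obtain ⟨N₀, hN₀⟩ := hT.toFinset.exists_nat_subset_range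
  have hEq : ∀ N, hT.toFinset ⊆ Finset.range N →
      ∏ n ∈ Finset.range N, (1 - f (x n)) = ∏ n ∈ hT.toFinset, (1 - f (x n)) := fun N hN => by
    refine (Finset.prod_subset hN fun n _ hn => ?_).symm
    have : f (x n) = 0 := by
      by_contra hne
      exact hn (by simpa using hs n hne)
    rw [this, tsub_zero]
  refine le_antisymm ((iInf_le _ N₀).trans_eq (hEq N₀ hN₀)) (le_iInf fun N => ?_)
  rw [← hEq (max N₀ N) (hN₀.trans (Finset.range_mono (le_max_left _ _)))]
  exact hanti (le_max_right _ _)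

/-- The generating functional of a Poisson process at `1 - f`, for simple functions `f`. -/
theorem IsPoissonProcess.lintegral_iInf_prod_simpleFunc {Ω E : Type*} [MeasurableSpace Ω]
    [MeasurableSpace E] {P : Measure Ω} [IsProbabilityMeasure P] {Λ : Measure E} {X : ℕ → Ω → E}
    (h : IsPoissonProcess P Λ X) (f : SimpleFunc E ℝ≥0∞) (hf : ∀ x, f x ≤ 1)
    (hint : ∫⁻ x, f x ∂Λ ≠ ∞) :
    ∫⁻ ω, ⨅ N, ∏ n ∈ Finset.range N, (1 - f (X n ω)) ∂P =
      ENNReal.ofReal (Real.exp (-(∫⁻ x, f x ∂Λ).toReal)) := by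
  classical
  -- The value `0` is dropped: its fibre may have infinite intensity, but its points contribute
  -- factors `1`. Integrability makes the other fibres of finite intensity.
  set s := f.range.filter (· ≠ 0) with hs
  have hA : ∀ v, MeasurableSet (f ⁻¹' {v}) := f.measurableSet_fiber
  have hv1 : ∀ v ∈ s, v ≤ 1 := fun v hv => by
    obtain ⟨x, rfl⟩ := SimpleFunc.mem_range.1 (Finset.mem_filter.1 hv).1
    exact hf x
  have hsum : ∫⁻ x, f x ∂Λ = ∑ v ∈ s, v * Λ (f ⁻¹' {v}) := by
    rw [SimpleFunc.lintegral_eq_lintegral, SimpleFunc.lintegral, hs, Finset.sum_filter_of_ne]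
    intro v _ hv h0
    simp [h0] at hv
  have hfin : ∀ v ∈ s, v * Λ (f ⁻¹' {v}) ≠ ∞ := by
    rw [hsum] at hint
    exact fun v hv => ne_top_of_le_ne_top hint
      (Finset.single_le_sum (f := fun v => v * Λ (f ⁻¹' {v})) (fun _ _ => zero_le) hv)
  have hΛ : ∀ v ∈ s, Λ (f ⁻¹' {v}) < ∞ := fun v hv => lt_top_iff_ne_top.2 fun htop =>
    hfin v hv (by rw [htop, ENNReal.mul_top (Finset.mem_filter.1 hv).2])
  have hae : ∀ᵐ ω ∂P, ∀ v ∈ s, pointCount X (f ⁻¹' {v}) ω ≠ ⊤ :=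
    (ae_ball_iff s.countable_toSet).2 fun v hv => h.pointCount_ne_top (hA v) (hΛ v hv)
  have hind : iIndepFun (fun i : Fin s.card =>
      pointCount X (f ⁻¹' {((s.equivFin.symm i : s) : ℝ≥0∞)})) P := by
    refine h.indep_count _ _ (fun i => hA _) (fun i => hΛ _ (s.equivFin.symm i).2) ?_
    intro i j hij
    refine Disjoint.preimage _ (Set.disjoint_singleton.2 fun he => hij ?_)
    exact s.equivFin.symm.injective (Subtype.ext he)
  have hreindex : ∀ g : ℝ≥0∞ → ℝ≥0∞,
      ∏ v ∈ s, g v = ∏ i : Fin s.card, g (s.equivFin.symm i : s) := fun g => by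
    rw [← Finset.prod_coe_sort, Equiv.prod_comp s.equivFin.symm (fun v : s => g v)]
  calc ∫⁻ ω, ⨅ N, ∏ n ∈ Finset.range N, (1 - f (X n ω)) ∂P
      = ∫⁻ ω, ∏ i : Fin s.card, (1 - ((s.equivFin.symm i : s) : ℝ≥0∞)) ^
          (pointCount X (f ⁻¹' {((s.equivFin.symm i : s) : ℝ≥0∞)}) ω).toNat ∂P := by
        refine lintegral_congr_ae ?_
        filter_upwards [hae] with ω hω
        rw [← hreindex fun v => (1 - v) ^ (pointCount X (f ⁻¹' {v}) ω).toNat]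
        refine iInf_prod_range_one_sub (f := f) (x := fun n => X n ω) s (fun n hn => ?_) hω
        exact Finset.mem_filter.2 ⟨f.mem_range_self _, hn⟩
    _ = ∏ v ∈ s, ∫⁻ ω, (1 - v) ^ (pointCount X (f ⁻¹' {v}) ω).toNat ∂P := by
        rw [hreindex fun v => ∫⁻ ω, (1 - v) ^ (pointCount X (f ⁻¹' {v}) ω).toNat ∂P]
        refine lintegral_prod_eq_prod_lintegral_of_indepFun Finset.univ
          (fun (i : Fin s.card) ω => (1 - ((s.equivFin.symm i : s) : ℝ≥0∞)) ^
          (pointCount X (f ⁻¹' {((s.equivFin.symm i : s) : ℝ≥0∞)}) ω).toNat) ?_ ?_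
        · exact hind.comp (fun i k => (1 - ((s.equivFin.symm i : s) : ℝ≥0∞)) ^ k.toNat)
            fun i => Measurable.of_discrete
        · exact fun i => (Measurable.of_discrete
            (f := fun k : ℕ∞ => (1 - ((s.equivFin.symm i : s) : ℝ≥0∞)) ^ k.toNat)).comp
            (measurable_pointCount h.measurable (hA _))
    _ = ENNReal.ofReal (Real.exp (-(∫⁻ x, f x ∂Λ).toReal)) := by
        rw [Finset.prod_congr rfl fun v hv =>
          h.lintegral_pow_pointCount (hA v) (hΛ v hv) (hv1 v hv), hsum, ENNReal.toReal_sum hfin,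
          ← Finset.sum_neg_distrib, Real.exp_sum,
          ENNReal.ofReal_prod_of_nonneg fun v _ => (Real.exp_pos _).le]

/-- The generating functional of a Poisson process at `1 - f`. -/
theorem IsPoissonProcess.lintegral_iInf_prod {Ω E : Type*} [MeasurableSpace Ω]
    [MeasurableSpace E] {P : Measure Ω} [IsProbabilityMeasure P] {Λ : Measure E} {X : ℕ → Ω → E}
    (h : IsPoissonProcess P Λ X) {f : E → ℝ≥0∞} (hfm : Measurable f) (hf : ∀ x, f x ≤ 1)
    (hint : ∫⁻ x, f x ∂Λ ≠ ∞) :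
    ∫⁻ ω, ⨅ N, ∏ n ∈ Finset.range N, (1 - f (X n ω)) ∂P =
      ENNReal.ofReal (Real.exp (-(∫⁻ x, f x ∂Λ).toReal)) := by
  set g := SimpleFunc.eapprox f
  have hmono : Monotone g := SimpleFunc.monotone_eapprox f
  have hle : ∀ m x, g m x ≤ f x := fun m x =>
    (le_iSup (fun m => g m x) m).trans_eq (SimpleFunc.iSup_eapprox_apply hfm x)
  have hlint : ∀ m, ∫⁻ x, g m x ∂Λ ≤ ∫⁻ x, f x ∂Λ := fun m => lintegral_mono (hle m)
  -- The two infima commute, so the limit in `m` is only needed for finite products, which are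
  -- continuous.
  have hswap : ∀ ω, ⨅ N, ∏ n ∈ Finset.range N, (1 - f (X n ω)) =
      ⨅ m, ⨅ N, ∏ n ∈ Finset.range N, (1 - g m (X n ω)) := by
    intro ω
    rw [iInf_comm]
    refine iInf_congr fun N => ?_
    have hanti : Antitone fun m => ∏ n ∈ Finset.range N, (1 - g m (X n ω)) := fun a b hab =>
      Finset.prod_le_prod' fun n _ => tsub_le_tsub_left (hmono hab _) _
    refine tendsto_nhds_unique ?_ (tendsto_atTop_iInf hanti)
    refine ENNReal.tendsto_finsetProd_of_ne_top _ (fun n _ => ?_) (fun n _ => ?_)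
    · exact ENNReal.Tendsto.sub tendsto_const_nhds (SimpleFunc.tendsto_eapprox hfm _)
        (Or.inl ENNReal.one_ne_top)
    · exact ne_top_of_le_ne_top ENNReal.one_ne_top tsub_le_self
  simp_rw [hswap]
  have hXm := h.measurable
  rw [lintegral_iInf]
  · have hgs := fun m => h.lintegral_iInf_prod_simpleFunc (g m) (fun x => (hle m x).trans (hf x))
      (ne_top_of_le_ne_top hint (hlint m))
    simp_rw [hgs]
    have hanti : Antitone fun m => ENNReal.ofReal (Real.exp (-(∫⁻ x, g m x ∂Λ).toReal)) :=
      fun a b hab => ENNReal.ofReal_le_ofReal (Real.exp_le_exp.2 (neg_le_neg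
        (ENNReal.toReal_mono (ne_top_of_le_ne_top hint (hlint b)) (lintegral_mono (hmono hab)))))
    refine tendsto_nhds_unique (tendsto_atTop_iInf hanti) ?_
    refine (ENNReal.continuous_ofReal.tendsto _).comp ((Real.continuous_exp.tendsto _).comp
      (((ENNReal.tendsto_toReal hint).comp ?_).neg))
    exact lintegral_tendsto_of_tendsto_of_monotone (fun m => (g m).measurable.aemeasurable)
      (Filter.Eventually.of_forall fun x a b hab => hmono hab x)
      (Filter.Eventually.of_forall fun x => SimpleFunc.tendsto_eapprox hfm x)
  · exact fun m => Measurable.iInf fun N => Finset.measurable_prod _ fun n _ =>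
      measurable_const.sub ((g m).measurable.comp (hXm n))
  · exact fun a b hab ω => iInf_mono fun N =>
      Finset.prod_le_prod' fun n _ => tsub_le_tsub_left (hmono hab _) _
  -- Decreasing limits need one finite integral; the empty product at `N = 0` bounds the integrand
  -- by `1`.
  · refine ne_top_of_le_ne_top ENNReal.one_ne_top ((lintegral_mono fun ω => iInf_le _ 0).trans ?_)
    simp

/-! ### Moments of the log-normal shadowing law -/

theorem measurable_ten_rpow_div_ten : Measurable fun t : ℝ => (10 : ℝ) ^ (t / 10) := by
  fun_prop

instance isProbabilityMeasure_shadowingLaw (w : ℝ) (δ : ℝ≥0) :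
    IsProbabilityMeasure (shadowingLaw w δ) :=
  Measure.isProbabilityMeasure_map measurable_ten_rpow_div_ten.aemeasurable

theorem ae_pos_shadowingLaw (w : ℝ) (δ : ℝ≥0) : ∀ᵐ c ∂shadowingLaw w δ, 0 < c := by
  rw [shadowingLaw, ae_map_iff measurable_ten_rpow_div_ten.aemeasurable measurableSet_Ioi]
  exact Filter.Eventually.of_forall fun t => by positivity

/-- Powers of the gain become exponentials of a linear function of a Gaussian variable, so moments
of every real order are finite and positive. -/
theorem ten_rpow_div_ten_rpow (s t : ℝ) :
    ((10 : ℝ) ^ (t / 10)) ^ s = Real.exp ((Real.log 10 / 10 * s) * t) := by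
  rw [← Real.rpow_mul (by norm_num), Real.rpow_def_of_pos (by norm_num)]
  ring_nf

theorem integrable_rpow_shadowingLaw (w : ℝ) (δ : ℝ≥0) (s : ℝ) :
    Integrable (fun c : ℝ => c ^ s) (shadowingLaw w δ) := by
  rw [shadowingLaw, integrable_map_measure (by fun_prop) (by fun_prop)]
  simp only [Function.comp_def, ten_rpow_div_ten_rpow]
  exact integrable_exp_mul_gaussianReal _

theorem integral_rpow_shadowingLaw_pos (w : ℝ) (δ : ℝ≥0) (s : ℝ) :
    0 < ∫ c, c ^ s ∂shadowingLaw w δ := by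
  rw [shadowingLaw, integral_map (by fun_prop) (by fun_prop)]
  simp only [ten_rpow_div_ten_rpow]
  exact integral_exp_pos (integrable_exp_mul_gaussianReal _)

theorem displacedDensity_pos (d : ℕ) {lam : ℝ} (hlam : 0 < lam) (α w : ℝ) (δ : ℝ≥0) :
    0 < displacedDensity d lam α w δ :=
  mul_pos hlam (integral_rpow_shadowingLaw_pos w δ _)

/-! ### Independent marking and void probabilities -/

/-- Given the positions, the marks are still i.i.d. of law `μ`, so avoidance probabilities multiply.
The passage to all points is a separate monotone limit. -/
theorem measure_forall_lt_notMem {Ω E F : Type*} [MeasurableSpace Ω] [MeasurableSpace E]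
    [MeasurableSpace F] {P : Measure Ω} [IsProbabilityMeasure P] {μ : Measure F}
    [IsProbabilityMeasure μ] {X : ℕ → Ω → E} {χ : ℕ → Ω → F} (hX : ∀ n, Measurable (X n))
    (hχ : ∀ n, Measurable (χ n)) (hlaw : ∀ n, P.map (χ n) = μ) (hind : iIndepFun χ P)
    (hXχ : IndepFun (fun ω n => X n ω) (fun ω n => χ n ω) P) {D : Set (E × F)}
    (hD : MeasurableSet D) (N : ℕ) :
    P {ω | ∀ n ∈ Finset.range N, (X n ω, χ n ω) ∉ D} =
      ∫⁻ ω, ∏ n ∈ Finset.range N, (1 - μ (Prod.mk (X n ω) ⁻¹' D)) ∂P := by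
  have hXm : Measurable fun ω n => X n ω := measurable_pi_lambda _ hX
  have hχm : Measurable fun ω n => χ n ω := measurable_pi_lambda _ hχ
  set S : Set ((ℕ → E) × (ℕ → F)) := {p | ∀ n ∈ Finset.range N, (p.1 n, p.2 n) ∉ D} with hS
  have hSm : MeasurableSet S := by
    have : S = ⋂ n ∈ Finset.range N, (fun p : (ℕ → E) × (ℕ → F) => (p.1 n, p.2 n)) ⁻¹' Dᶜ := by
      ext p; simp [hS]
    rw [this]
    exact Finset.measurableSet_biInter _ fun n _ =>
      (by fun_prop : Measurable fun p : (ℕ → E) × (ℕ → F) => (p.1 n, p.2 n)) hD.compl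
  have hprod := hXχ.map_prod_eq_prod_map_map hXm.aemeasurable hχm.aemeasurable
  calc P {ω | ∀ n ∈ Finset.range N, (X n ω, χ n ω) ∉ D}
      = (P.map fun ω => ((fun n => X n ω), (fun n => χ n ω))) S := by
        rw [Measure.map_apply (hXm.prodMk hχm) hSm]; rfl
    _ = ∫⁻ x, P.map (fun ω n => χ n ω) (Prod.mk x ⁻¹' S) ∂(P.map fun ω n => X n ω) := by
        have := Measure.isProbabilityMeasure_map (μ := P) hχm.aemeasurable
        rw [hprod, Measure.prod_apply hSm]
    _ = ∫⁻ x, ∏ n ∈ Finset.range N, (1 - μ (Prod.mk (x n) ⁻¹' D)) ∂(P.map fun ω n => X n ω) := by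
        refine lintegral_congr fun x => ?_
        rw [Measure.map_apply hχm (measurable_prodMk_left hSm)]
        have hset : (fun ω n => χ n ω) ⁻¹' (Prod.mk x ⁻¹' S) =
            ⋂ n ∈ Finset.range N, χ n ⁻¹' (Prod.mk (x n) ⁻¹' D)ᶜ := by
          ext ω; simp [hS]
        rw [hset, hind.measure_inter_preimage_eq_mul _
          fun n _ => (measurable_prodMk_left hD).compl]
        refine Finset.prod_congr rfl fun n _ => ?_
        rw [← Measure.map_apply (hχ n) (measurable_prodMk_left hD).compl, hlaw n,
          prob_compl_eq_one_sub (measurable_prodMk_left hD)]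
    _ = _ := by
        rw [lintegral_map _ hXm]
        exact Finset.measurable_prod _ fun n _ => measurable_const.sub
          ((measurable_measure_prodMk_left hD).comp (measurable_pi_apply n))

/-- Marking: if the points of a Poisson process of intensity `Λ` carry independent marks of law
`μ`, then the probability that no marked point lies in `D` is `exp (-(Λ.prod μ) D)`. -/
theorem IsPoissonProcess.measure_forall_notMem {Ω E F : Type*} [MeasurableSpace Ω]
    [MeasurableSpace E] [MeasurableSpace F] {P : Measure Ω} [IsProbabilityMeasure P]
    {Λ : Measure E} [SFinite Λ] {μ : Measure F} [IsProbabilityMeasure μ] {X : ℕ → Ω → E}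
    {χ : ℕ → Ω → F} (h : IsPoissonProcess P Λ X) (hχ : ∀ n, Measurable (χ n))
    (hlaw : ∀ n, P.map (χ n) = μ) (hind : iIndepFun χ P)
    (hXχ : IndepFun (fun ω n => X n ω) (fun ω n => χ n ω) P) {D : Set (E × F)}
    (hD : MeasurableSet D) (hfin : Λ.prod μ D ≠ ∞) :
    P {ω | ∀ n, (X n ω, χ n ω) ∉ D} = ENNReal.ofReal (Real.exp (-(Λ.prod μ D).toReal)) := by
  have hfm : Measurable fun x => μ (Prod.mk x ⁻¹' D) := measurable_measure_prodMk_left hD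
  have hXm := h.measurable
  have hset : {ω | ∀ n, (X n ω, χ n ω) ∉ D} =
      ⋂ N, {ω | ∀ n ∈ Finset.range N, (X n ω, χ n ω) ∉ D} := by
    ext ω
    simp only [Set.mem_ofPred_eq, Set.mem_iInter, Finset.mem_range]
    exact ⟨fun hω N n _ => hω n, fun hω n => hω (n + 1) n n.lt_succ_self⟩
  have hm : ∀ N, MeasurableSet {ω | ∀ n ∈ Finset.range N, (X n ω, χ n ω) ∉ D} := fun N => by
    have : {ω | ∀ n ∈ Finset.range N, (X n ω, χ n ω) ∉ D} =
        ⋂ n ∈ Finset.range N, (fun ω => (X n ω, χ n ω)) ⁻¹' Dᶜ := by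
      ext ω; simp
    rw [this]
    exact Finset.measurableSet_biInter _ fun n _ => ((hXm n).prodMk (hχ n)) hD.compl
  have hanti : Antitone fun N => {ω | ∀ n ∈ Finset.range N, (X n ω, χ n ω) ∉ D} :=
    fun a b hab ω hω n hn => hω n (Finset.range_mono hab hn)
  rw [hset, hanti.measure_iInter (fun N => (hm N).nullMeasurableSet) ⟨0, measure_ne_top _ _⟩]
  simp_rw [measure_forall_lt_notMem hXm hχ hlaw hind hXχ hD]
  rw [← lintegral_iInf, h.lintegral_iInf_prod hfm (fun x => prob_le_one), Measure.prod_apply hD]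
  · rwa [← Measure.prod_apply hD]
  · exact fun N => Finset.measurable_prod _ fun n _ => measurable_const.sub (hfm.comp (hXm n))
  · intro a b hab ω
    exact Finset.prod_le_prod_of_subset_of_le_one' (Finset.range_mono hab)
      fun n _ _ => tsub_le_self
  · simp

/-! ### Distance to the nearest displaced point -/

theorem bddBelow_range_norm_displaced {Ω E : Type*} [NormedAddCommGroup E] [NormedSpace ℝ E]
    {X : ℕ → Ω → E} {χ : ℕ → Ω → ℝ} {α : ℝ} (ω : Ω) :
    BddBelow (Set.range fun n => ‖(χ n ω ^ (-1 / α)) • X n ω‖) :=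
  ⟨0, by rintro _ ⟨n, rfl⟩; exact norm_nonneg _⟩

theorem nearestDist_nonneg {Ω E : Type*} [NormedAddCommGroup E] [NormedSpace ℝ E]
    {X : ℕ → Ω → E} {χ : ℕ → Ω → ℝ} {α : ℝ} (ω : Ω) :
    0 ≤ nearestDist α X χ ω :=
  Real.iInf_nonneg fun _ => norm_nonneg _

theorem measurable_nearestDist {Ω E : Type*} [MeasurableSpace Ω] [NormedAddCommGroup E]
    [NormedSpace ℝ E] [MeasurableSpace E] [BorelSpace E] [SecondCountableTopology E]
    {X : ℕ → Ω → E} {χ : ℕ → Ω → ℝ} {α : ℝ}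
    (hX : ∀ n, Measurable (X n)) (hχ : ∀ n, Measurable (χ n)) :
    Measurable (nearestDist α X χ) :=
  Measurable.iInf fun n => (((hχ n).pow_const _).smul (hX n)).norm

/-- The law of the distance to the nearest displaced point; `b` is the volume of the unit ball. -/
theorem IsShadowedPPP.measure_le_nearestDist {Ω E : Type*} [MeasurableSpace Ω]
    [NormedAddCommGroup E] [NormedSpace ℝ E] [MeasureSpace E] [BorelSpace E]
    [FiniteDimensional ℝ E] [Nontrivial E] [(volume : Measure E).IsAddHaarMeasure]
    {P : Measure Ω} [IsProbabilityMeasure P] {lam w α : ℝ} {δ : ℝ≥0} {X : ℕ → Ω → E}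
    {χ : ℕ → Ω → ℝ} (h : IsShadowedPPP P lam w δ X χ) (hlam : 0 ≤ lam) {b : ℝ} (hb0 : 0 ≤ b)
    (hb : volume (Metric.ball (0 : E) 1) = ENNReal.ofReal b) {r : ℝ} (hr : 0 ≤ r) :
    P {ω | r ≤ nearestDist α X χ ω} = ENNReal.ofReal
      (Real.exp (-(b * displacedDensity (Module.finrank ℝ E) lam α w δ *
        r ^ Module.finrank ℝ E))) := by
  set d := Module.finrank ℝ E
  have : SecondCountableTopology E :=
    have := FiniteDimensional.proper ℝ E
    inferInstance
  set Λ : Measure E := ENNReal.ofReal lam • (volume : Measure E) with hΛ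
  have : SFinite Λ := by rw [hΛ]; infer_instance
  set D : Set (E × ℝ) := {p | ‖(p.2 ^ (-1 / α)) • p.1‖ < r} with hDdef
  have hD : MeasurableSet D := measurableSet_lt
    (((measurable_snd.pow_const _).smul measurable_fst).norm) measurable_const
  have hset : {ω | r ≤ nearestDist α X χ ω} = {ω | ∀ n, (X n ω, χ n ω) ∉ D} := by
    ext ω
    simp only [Set.mem_ofPred_eq, nearestDist, le_ciInf_iff (bddBelow_range_norm_displaced ω),
      hDdef, not_lt]
  have hslice : ∀ c : ℝ, 0 < c → Λ ((fun x => (x, c)) ⁻¹' D) =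
      ENNReal.ofReal (b * lam * r ^ d * c ^ ((d : ℝ) / α)) := fun c hc => by
    have hball : (fun x => (x, c)) ⁻¹' D = Metric.ball 0 (r * c ^ (1 / α)) := by
      ext x
      have hcp : 0 < c ^ (1 / α) := Real.rpow_pos_of_pos hc _
      simp only [hDdef, Set.mem_preimage, Set.mem_ofPred_eq, mem_ball_zero_iff, norm_smul]
      rw [Real.norm_of_nonneg (Real.rpow_nonneg hc.le _), neg_div, Real.rpow_neg hc.le,
        inv_mul_lt_iff₀ hcp, mul_comm]
    rw [hball, hΛ, Measure.smul_apply, Measure.addHaar_ball _ _ (by positivity), hb,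
      smul_eq_mul, ← ENNReal.ofReal_mul (by positivity), ← ENNReal.ofReal_mul hlam, mul_pow,
      ← Real.rpow_mul_natCast hc.le]
    congr 1
    rw [one_div_mul_eq_div]
    ring
  have hprod : Λ.prod (shadowingLaw w δ) D =
      ENNReal.ofReal (b * displacedDensity d lam α w δ * r ^ d) := by
    -- Positions are integrated out first, at a fixed gain, so that each slice is a ball and the
    -- gain integral is the moment of order `d / α`.
    rw [Measure.prod_apply_symm hD, lintegral_congr_ae
      ((ae_pos_shadowingLaw w δ).mono fun c hc => hslice c hc),
      ← ofReal_integral_eq_lintegral_ofReal, integral_const_mul, displacedDensity]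
    · ring_nf
    · exact (integrable_rpow_shadowingLaw w δ _).const_mul _
    · filter_upwards [ae_pos_shadowingLaw w δ] with c hc
      have := Real.rpow_nonneg hc.le ((d : ℝ) / α)
      positivity
  have hdens : 0 ≤ displacedDensity d lam α w δ :=
    mul_nonneg hlam (integral_rpow_shadowingLaw_pos w δ _).le
  rw [hset, h.poisson.measure_forall_notMem h.shadowing_measurable h.shadowing_law
    h.shadowing_indep h.indep hD (by rw [hprod]; exact ENNReal.ofReal_ne_top), hprod,
    ENNReal.toReal_ofReal (by positivity)]

/-! ### The association integrals -/

/-- A Laplace-type integral of a Gaussian over a half-line, by completing the square. -/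
theorem integral_assocIntegrand_eq_assocClosedForm {lamM lamS α K : ℝ} (hM : 0 < lamM)
    (hS : 0 < lamS) (hα : 0 < α) (hK : 0 < K) :
    ∫ x in Set.Ioi 0, assocIntegrand lamM lamS α α K x = assocClosedForm lamM lamS α K := by
  have hk : 0 < K ^ (2 / α) := Real.rpow_pos_of_pos hK _
  set k := K ^ (2 / α) with hkdef
  set a := lamM * Real.pi * k with ha
  have ha0 : 0 < a := by positivity
  set q := Real.sqrt a with hq
  have hq0 : 0 < q := Real.sqrt_pos.2 ha0
  have hqa : q ^ 2 = a := Real.sq_sqrt ha0.le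
  -- With `q = √a`: `a x² + 2 λ_S x = (q x + λ_S / q)² - λ_S² / a`.
  have hint : ∀ x : ℝ, assocIntegrand lamM lamS α α K x =
      2 * lamS * Real.exp (lamS ^ 2 / a) * Real.exp (-(q * x + lamS / q) ^ 2) := fun x => by
    rw [assocIntegrand, mul_div_assoc, div_self hα.ne', mul_one, mul_assoc (2 * lamS),
      ← Real.exp_add, ← hkdef, Real.rpow_two]
    congr 2
    rw [← hqa]
    have : lamM * Real.pi * k = q ^ 2 := hqa.symm
    rw [show -lamM * Real.pi * k * x ^ 2 = -(q ^ 2) * x ^ 2 by rw [← this]; ring]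
    field_simp
    ring
  have hshift : ∫ t in Set.Ioi 0, Real.exp (-(t + lamS / q) ^ 2) =
      ∫ t in Set.Ioi (lamS / q), Real.exp (-t ^ 2) := by
    have := (measurePreserving_add_right (volume : Measure ℝ) (lamS / q)).setIntegral_preimage_emb
      (measurableEmbedding_addRight _) (fun t => Real.exp (-t ^ 2)) (Set.Ioi (lamS / q))
    rw [← this]
    congr 2
    ext t
    simp
  simp_rw [hint]
  rw [integral_const_mul, integral_comp_mul_left_Ioi
    (fun t => Real.exp (-(t + lamS / q) ^ 2)) 0 hq0, mul_zero, hshift, assocClosedForm, erfc,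
    ← hkdef, ← ha, ← hq, smul_eq_mul]
  have hsq : Real.sqrt (lamS ^ 2 / (lamM * k)) = lamS * Real.sqrt Real.pi / q := by
    rw [hq, Real.sqrt_eq_iff_eq_sq (by positivity) (by positivity), div_pow, mul_pow,
      Real.sq_sqrt Real.pi_pos.le, Real.sq_sqrt ha0.le, ha]
    field_simp
  rw [hsq]
  have := Real.sqrt_pos.2 Real.pi_pos
  field_simp

theorem assocIntegrand_eq_mul (lamM lamS αM αS K x : ℝ) :
    assocIntegrand lamM lamS αM αS K x = 2 * lamS * Real.exp (-(2 * lamS) * x) *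
      Real.exp (-(Real.pi * lamM * (K ^ (2 / αM) * x ^ (2 * αS / αM)))) := by
  rw [assocIntegrand, mul_assoc (2 * lamS), ← Real.exp_add]
  ring_nf

theorem integrableOn_assocIntegrand {lamM lamS K : ℝ} (αM αS : ℝ) (hM : 0 < lamM) (hS : 0 < lamS)
    (hK : 0 < K) : IntegrableOn (assocIntegrand lamM lamS αM αS K) (Set.Ioi 0) := by
  -- The exponential density dominates: the other factor is at most one, whatever the exponents.
  have hdom : IntegrableOn (fun x => 2 * lamS * Real.exp (-(2 * lamS) * x)) (Set.Ioi 0) :=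
    (exp_neg_integrableOn_Ioi 0 (by positivity : 0 < 2 * lamS)).const_mul _
  refine Integrable.mono' hdom ?_ ?_
  · unfold assocIntegrand
    exact (by fun_prop : Measurable fun x : ℝ => 2 * lamS * Real.exp (-lamM * Real.pi *
      K ^ (2 / αM) * x ^ (2 * αS / αM) - 2 * lamS * x)).aestronglyMeasurable
  · filter_upwards [ae_restrict_mem measurableSet_Ioi] with x hx
    have hx : 0 < x := hx
    have hxp := Real.rpow_pos_of_pos hx (2 * αS / αM)
    have hkp := Real.rpow_pos_of_pos hK (2 / αM)
    rw [assocIntegrand_eq_mul, Real.norm_of_nonneg (by positivity)]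
    refine mul_le_of_le_one_right (by positivity) (Real.exp_le_one_iff.2 ?_)
    have : 0 ≤ Real.pi * lamM * (K ^ (2 / αM) * x ^ (2 * αS / αM)) := by positivity
    linarith

/-! ### Comparing the two distances -/

/-- A nonnegative random variable with exponential survival function has exponential density. -/
theorem map_eq_withDensity_of_measure_le {Ω : Type*} [MeasurableSpace Ω] {P : Measure Ω}
    [IsProbabilityMeasure P] {Y : Ω → ℝ} (hY : Measurable Y) (hY0 : ∀ ω, 0 ≤ Y ω) {l : ℝ}
    (hl : 0 < l) (h : ∀ r, 0 ≤ r → P {ω | r ≤ Y ω} = ENNReal.ofReal (Real.exp (-(l * r)))) :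
    P.map Y = (volume.restrict (Set.Ioi 0)).withDensity
      fun x => ENNReal.ofReal (l * Real.exp (-l * x)) := by
  have := Measure.isProbabilityMeasure_map (μ := P) hY.aemeasurable
  -- Half-lines determine a finite measure; negative thresholds reduce to `0` because `Y` is
  -- nonnegative.
  refine Measure.ext_of_Ici _ _ fun a => ?_
  have hmax : Y ⁻¹' Set.Ici a = {ω | max a 0 ≤ Y ω} := by
    ext ω
    simp [hY0 ω]
  have hset : (Set.Ici a ∩ Set.Ioi 0 : Set ℝ) =ᵐ[volume] Set.Ioi (max a 0) := by
    rw [← Set.Ioi_inter_Ioi]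
    exact (Ioi_ae_eq_Ici.symm).inter (ae_eq_refl _)
  rw [Measure.map_apply hY measurableSet_Ici, hmax, h _ (le_max_right _ _),
    withDensity_apply _ measurableSet_Ici, Measure.restrict_restrict measurableSet_Ici,
    Measure.restrict_congr_set hset, ← ofReal_integral_eq_lintegral_ofReal,
    integral_const_mul, integral_exp_mul_Ioi (by linarith)]
  · congr 1
    rw [neg_div_neg_eq, neg_mul]
    field_simp
  · exact (exp_neg_integrableOn_Ioi _ hl).const_mul _
  · exact Filter.Eventually.of_forall fun x => by positivity

/-- Let `r` decrease to `0` in the survival function. Positivity is needed because `Real.rpow` gives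
`0` the value `0` at nonzero exponents, which breaks the comparison of powers at distance zero. -/
theorem ae_pos_of_measure_le {Ω : Type*} [MeasurableSpace Ω] {P : Measure Ω}
    [IsProbabilityMeasure P] {Y : Ω → ℝ} (hY : Measurable Y) {b : ℝ} {d : ℕ} (hd : d ≠ 0)
    (h : ∀ r, 0 ≤ r → P {ω | r ≤ Y ω} = ENNReal.ofReal (Real.exp (-(b * r ^ d)))) :
    ∀ᵐ ω ∂P, 0 < Y ω := by
  have hms : MeasurableSet {ω | 0 < Y ω} := measurableSet_lt measurable_const hY
  refine (prob_compl_eq_zero_iff hms).2 (le_antisymm prob_le_one ?_)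
  have hcont : Continuous fun r : ℝ => ENNReal.ofReal (Real.exp (-(b * r ^ d))) :=
    ENNReal.continuous_ofReal.comp (by fun_prop)
  have hlim : Filter.Tendsto (fun r : ℝ => ENNReal.ofReal (Real.exp (-(b * r ^ d))))
      (nhdsWithin 0 (Set.Ioi 0)) (nhds 1) := by
    have := (hcont.tendsto 0).mono_left (nhdsWithin_le_nhds (s := Set.Ioi 0))
    simpa [hd] using this
  refine le_of_tendsto hlim ?_
  filter_upwards [self_mem_nhdsWithin] with r hr
  have hr : 0 < r := hr
  rw [← h r hr.le]
  exact measure_mono fun ω hω => hr.trans_le hω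

theorem mul_rpow_neg_le_rpow_neg_iff {K x y a b : ℝ} (hK : 0 < K) (hx : 0 < x) (hy : 0 < y)
    (ha : 0 < a) : K * x ^ (-a) ≤ y ^ (-b) ↔ K ^ (1 / a) * y ^ (b / a) ≤ x := by
  have hxa := Real.rpow_pos_of_pos hx a
  have hyb := Real.rpow_pos_of_pos hy b
  rw [Real.rpow_neg hx.le, Real.rpow_neg hy.le, ← div_eq_mul_inv, div_le_iff₀ hxa,
    inv_mul_eq_div, le_div_iff₀ hyb, div_eq_mul_one_div b, Real.rpow_mul hy.le,
    ← Real.mul_rpow hK.le hyb.le, one_div, Real.rpow_inv_le_iff_of_pos (by positivity) hx.le ha]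

theorem measure_mul_rpow_neg_le {Ω : Type*} [MeasurableSpace Ω] {P : Measure Ω}
    [IsProbabilityMeasure P] {xM xS : Ω → ℝ} {lamM lamS αM αS K : ℝ} (hmM : Measurable xM)
    (hmS : Measurable xS) (hS0 : ∀ ω, 0 ≤ xS ω) (hind : IndepFun xM xS P)
    (hlamM : 0 < lamM) (hlamS : 0 < lamS) (hαM : 0 < αM) (hK : 0 < K)
    (hM : ∀ r, 0 ≤ r → P {ω | r ≤ xM ω} = ENNReal.ofReal (Real.exp (-(Real.pi * lamM * r ^ 2))))
    (hS : ∀ r, 0 ≤ r → P {ω | r ≤ xS ω} = ENNReal.ofReal (Real.exp (-(2 * lamS * r)))) :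
    P.real {ω | K * xM ω ^ (-αM) ≤ xS ω ^ (-αS)} =
      ∫ x in Set.Ioi 0, assocIntegrand lamM lamS αM αS K x := by
  set S : Set (ℝ × ℝ) := {p | K * p.2 ^ (-αM) ≤ p.1 ^ (-αS)} with hSdef
  have hSm : MeasurableSet S := measurableSet_le (by fun_prop) (by fun_prop)
  have hpM := ae_pos_of_measure_le hmM two_ne_zero hM
  have hPS := map_eq_withDensity_of_measure_le hmS hS0 (by positivity : 0 < 2 * lamS) hS
  have hpMS := Measure.isProbabilityMeasure_map (μ := P) hmM.aemeasurable
  -- At `xS = s` the event is a lower bound on `xM`; the square in its survival function doubles the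
  -- exponents of `K` and `s`.
  have hslice : ∀ s : ℝ, 0 < s → P.map xM (Prod.mk s ⁻¹' S) = ENNReal.ofReal (Real.exp
      (-(Real.pi * lamM * (K ^ (2 / αM) * s ^ (2 * αS / αM))))) := fun s hs => by
    rw [Measure.map_apply hmM (measurable_prodMk_left hSm)]
    have hnn : 0 ≤ K ^ (1 / αM) * s ^ (αS / αM) := by positivity
    have heq : K ^ (2 / αM) * s ^ (2 * αS / αM) = (K ^ (1 / αM) * s ^ (αS / αM)) ^ 2 := by
      rw [mul_pow, ← Real.rpow_mul_natCast hK.le, ← Real.rpow_mul_natCast hs.le]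
      push_cast
      ring_nf
    rw [heq, ← hM _ hnn]
    refine measure_congr ?_
    filter_upwards [hpM] with ω hω
    exact propext (mul_rpow_neg_le_rpow_neg_iff hK hω hs hαM)
  have hint := integrableOn_assocIntegrand αM αS hlamM hlamS hK
  have hnonneg : ∀ x, 0 ≤ assocIntegrand lamM lamS αM αS K x := fun x => by
    unfold assocIntegrand; positivity
  have hmain : P {ω | K * xM ω ^ (-αM) ≤ xS ω ^ (-αS)} =
      ENNReal.ofReal (∫ x in Set.Ioi 0, assocIntegrand lamM lamS αM αS K x) := by
    calc P {ω | K * xM ω ^ (-αM) ≤ xS ω ^ (-αS)}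
        = (P.map fun ω => (xS ω, xM ω)) S := by
          rw [Measure.map_apply (hmS.prodMk hmM) hSm]; rfl
      _ = ∫⁻ s, P.map xM (Prod.mk s ⁻¹' S) ∂(P.map xS) := by
          rw [hind.symm.map_prod_eq_prod_map_map hmS.aemeasurable hmM.aemeasurable,
            Measure.prod_apply hSm]
      _ = ∫⁻ s in Set.Ioi 0, ENNReal.ofReal (assocIntegrand lamM lamS αM αS K s) := by
          rw [hPS, lintegral_withDensity_eq_lintegral_mul _ (by fun_prop)
            (measurable_measure_prodMk_left hSm)]
          refine setLIntegral_congr_fun measurableSet_Ioi fun s hs => ?_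
          rw [Pi.mul_apply, hslice s hs, ← ENNReal.ofReal_mul (by positivity),
            assocIntegrand_eq_mul]
      _ = _ := (ofReal_integral_eq_lintegral_ofReal hint
          (Filter.Eventually.of_forall hnonneg)).symm
  rw [measureReal_def, hmain, ENNReal.toReal_ofReal (integral_nonneg hnonneg)]

/-- A tie forces `xS` to be one value determined by `xM`. As `xS` is independent of `xM` and has no
atoms, every slice is null. -/
theorem ae_mul_rpow_neg_ne {Ω : Type*} [MeasurableSpace Ω] {P : Measure Ω}
    [IsProbabilityMeasure P] {xM xS : Ω → ℝ} {lamS αM αS K : ℝ} (hmM : Measurable xM)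
    (hmS : Measurable xS) (hS0 : ∀ ω, 0 ≤ xS ω) (hind : IndepFun xM xS P)
    (hlamS : 0 < lamS) (hαS : 0 < αS)
    (hS : ∀ r, 0 ≤ r → P {ω | r ≤ xS ω} = ENNReal.ofReal (Real.exp (-(2 * lamS * r)))) :
    ∀ᵐ ω ∂P, K * xM ω ^ (-αM) ≠ xS ω ^ (-αS) := by
  have hPS := map_eq_withDensity_of_measure_le hmS hS0 (by positivity : 0 < 2 * lamS) hS
  have hpMS := Measure.isProbabilityMeasure_map (μ := P) hmS.aemeasurable
  have hna : NullSingletonClass (P.map xS) := by rw [hPS]; infer_instance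
  set S : Set (ℝ × ℝ) := {p | p.2 = (K * p.1 ^ (-αM)) ^ (-αS)⁻¹} with hSdef
  have hSm : MeasurableSet S := measurableSet_eq_fun (by fun_prop) (by fun_prop)
  have hzero : (P.map fun ω => (xM ω, xS ω)) S = 0 := by
    rw [hind.map_prod_eq_prod_map_map hmM.aemeasurable hmS.aemeasurable,
      Measure.prod_apply hSm]
    refine (lintegral_congr fun m => ?_).trans lintegral_zero
    have hslice : Prod.mk m ⁻¹' S = {(K * m ^ (-αM)) ^ (-αS)⁻¹} := by
      ext s
      simp [hSdef]
    rw [hslice, measure_singleton]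
  rw [Measure.map_apply (hmM.prodMk hmS) hSm] at hzero
  refine measure_mono_null (fun ω hω => ?_) hzero
  have hω : K * xM ω ^ (-αM) = xS ω ^ (-αS) := not_not.1 hω
  change xS ω = (K * xM ω ^ (-αM)) ^ (-αS)⁻¹
  rw [hω, Real.rpow_rpow_inv (hS0 ω) (by linarith)]

/-! ### The probability of Case 2 -/

theorem lemma2 {Ω : Type*} [MeasurableSpace Ω] (P : Measure Ω) [IsProbabilityMeasure P]
    -- densities, path-loss exponents, shadowing parameters, transmit powers and antenna gains
    (lam_m lam_s αM αS wM wS : ℝ) (δM δS : ℝ≥0) (PM PS PV GM GS0 GV0 GV1 : ℝ)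
    (hlam_m : 0 < lam_m) (hlam_s : 0 < lam_s) (hαM : 0 < αM) (hαS : 0 < αS)
    (hPM : 0 < PM) (hPS : 0 < PS) (hPV : 0 < PV)
    (hGM : 0 < GM) (hGS0 : 0 < GS0) (hGV0 : 0 < GV0) (hGV1 : 0 < GV1)
    -- MBSs in the plane; SBSs in a coordinate along the road of the typical vehicle
    (X : ℕ → Ω → EuclideanSpace ℝ (Fin 2)) (χM : ℕ → Ω → ℝ)
    (T : ℕ → Ω → ℝ) (χS : ℕ → Ω → ℝ)
    (hM : IsShadowedPPP P lam_m wM δM X χM)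
    (hS : IsShadowedPPP P lam_s wS δS T χS)
    (hMS : IndepFun (fun ω n => (X n ω, χM n ω)) (fun ω n => (T n ω, χS n ω)) P)
    (lamM lamS A B : ℝ)
    (hlamM : lamM = displacedDensity 2 lam_m αM wM δM)
    (hlamS : lamS = displacedDensity 1 lam_s αS wS δS)
    (hA : A = PM * GM / (PS * GS0)) (hB : B = PV * GV1 / (PV * GV0)) (hBA : B < A)
    (xM xS : Ω → ℝ) (hxM : xM = nearestDist αM X χM) (hxS : xS = nearestDist αS T χS)
    -- Case 2: MBS in the downlink and SBS (not MBS) in the uplink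
    (case2 : Set Ω)
    (hcase2 : case2 = {ω | AssocMBS PM GM αM PS GS0 αS (xM ω) (xS ω) ∧
      ¬ AssocMBS PV GV1 αM PV GV0 αS (xM ω) (xS ω)}) :
    (0 < lamM ∧ 0 < lamS ∧
      IntegrableOn (assocIntegrand lamM lamS αM αS B) (Set.Ioi 0) ∧
      IntegrableOn (assocIntegrand lamM lamS αM αS A) (Set.Ioi 0)) ∧
    P.real case2 =
      P.real {ω | B * xM ω ^ (-αM) < xS ω ^ (-αS) ∧ xS ω ^ (-αS) < A * xM ω ^ (-αM)} ∧
    P.real case2 =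
      (∫ x in Set.Ioi 0, assocIntegrand lamM lamS αM αS B x) -
        (∫ x in Set.Ioi 0, assocIntegrand lamM lamS αM αS A x) ∧
    (αS = αM →
      P.real case2 = assocClosedForm lamM lamS αM B - assocClosedForm lamM lamS αM A) := by
  have hlM : 0 < lamM := hlamM ▸ displacedDensity_pos 2 hlam_m αM wM δM
  have hlS : 0 < lamS := hlamS ▸ displacedDensity_pos 1 hlam_s αS wS δS
  have hA0 : 0 < A := by rw [hA]; positivity
  have hB0 : 0 < B := by rw [hB]; positivity
  have hmM : Measurable xM :=
    hxM ▸ measurable_nearestDist hM.poisson.measurable hM.shadowing_measurable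
  have hmS : Measurable xS :=
    hxS ▸ measurable_nearestDist hS.poisson.measurable hS.shadowing_measurable
  have hM0 : ∀ ω, 0 ≤ xM ω := fun ω => hxM ▸ nearestDist_nonneg ω
  have hS0 : ∀ ω, 0 ≤ xS ω := fun ω => hxS ▸ nearestDist_nonneg ω
  have hlawM : ∀ r, 0 ≤ r →
      P {ω | r ≤ xM ω} = ENNReal.ofReal (Real.exp (-(Real.pi * lamM * r ^ 2))) := fun r hr => by
    have := hM.measure_le_nearestDist (α := αM) hlam_m.le Real.pi_pos.le
      (by simp [EuclideanSpace.volume_ball, Real.sq_sqrt Real.pi_pos.le, one_add_one_eq_two]) hr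
    rwa [finrank_euclideanSpace_fin, ← hlamM, ← hxM] at this
  have hlawS : ∀ r, 0 ≤ r →
      P {ω | r ≤ xS ω} = ENNReal.ofReal (Real.exp (-(2 * lamS * r))) := fun r hr => by
    have := hS.measure_le_nearestDist (α := αS) hlam_s.le zero_le_two
      (by rw [Real.volume_ball, mul_one]) hr
    rwa [Module.finrank_self, pow_one, ← hlamS, ← hxS] at this
  have hind : IndepFun xM xS P := by
    have := hMS.comp
      (φ := fun s => ⨅ n, ‖((s n).2 ^ (-1 / αM)) • (s n).1‖)
      (ψ := fun s => ⨅ n, ‖((s n).2 ^ (-1 / αS)) • (s n).1‖)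
      (Measurable.iInf fun n => by fun_prop) (Measurable.iInf fun n => by fun_prop)
    rw [hxM, hxS]
    exact this
  have hprob : ∀ K, 0 < K → P.real {ω | K * xM ω ^ (-αM) ≤ xS ω ^ (-αS)} =
      ∫ x in Set.Ioi 0, assocIntegrand lamM lamS αM αS K x := fun K hK =>
    measure_mul_rpow_neg_le hmM hmS hS0 hind hlM hlS hαM hK hlawM hlawS
  have hassoc : ∀ {p g p' g' : ℝ}, 0 < p' → 0 < g' → ∀ ω,
      (AssocMBS p g αM p' g' αS (xM ω) (xS ω) ↔
        xS ω ^ (-αS) < p * g / (p' * g') * xM ω ^ (-αM)) := fun {p g p' g'} hp hg ω => by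
    rw [AssocMBS, gt_iff_lt, div_mul_eq_mul_div, lt_div_iff₀ (by positivity),
      mul_comm (xS ω ^ (-αS))]
  -- Not choosing an MBS in the uplink is the weak inequality at `B`; choosing one in the downlink
  -- negates the weak inequality at `A`.
  have hcase : case2 = {ω | B * xM ω ^ (-αM) ≤ xS ω ^ (-αS)} \
      {ω | A * xM ω ^ (-αM) ≤ xS ω ^ (-αS)} := by
    ext ω
    simp only [hcase2, Set.mem_ofPred_eq, Set.mem_sdiff, hassoc hPS hGS0, hassoc hPV hGV0, ← hA,
      ← hB, not_lt, not_le]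
    exact and_comm
  have hdiff : P.real case2 = (∫ x in Set.Ioi 0, assocIntegrand lamM lamS αM αS B x) -
      ∫ x in Set.Ioi 0, assocIntegrand lamM lamS αM αS A x := by
    rw [hcase, measureReal_sdiff, hprob B hB0, hprob A hA0]
    · exact fun ω hω => le_trans
        (mul_le_mul_of_nonneg_right hBA.le (Real.rpow_nonneg (hM0 ω) _)) hω
    · exact measurableSet_le ((hmM.pow_const _).const_mul _) (hmS.pow_const _)
  refine ⟨⟨hlM, hlS, integrableOn_assocIntegrand αM αS hlM hlS hB0,
    integrableOn_assocIntegrand αM αS hlM hlS hA0⟩, ?_, hdiff, ?_⟩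
  -- Only uplink ties, which the association rule gives to the SBS, separate the two events.
  · refine measureReal_congr ?_
    filter_upwards [ae_mul_rpow_neg_ne (K := B) (αM := αM) hmM hmS hS0 hind hlS hαS hlawS]
      with ω hω
    rw [hcase]
    refine propext ?_
    change (B * xM ω ^ (-αM) ≤ xS ω ^ (-αS) ∧ ¬ A * xM ω ^ (-αM) ≤ xS ω ^ (-αS)) ↔
      (B * xM ω ^ (-αM) < xS ω ^ (-αS) ∧ xS ω ^ (-αS) < A * xM ω ^ (-αM))
    rw [not_le, hω.le_iff_lt]
  · rintro rfl
    rw [hdiff, integral_assocIntegrand_eq_assocClosedForm hlM hlS hαS hB0,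
      integral_assocIntegrand_eq_assocClosedForm hlM hlS hαS hA0]
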